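/- **Generic signatures.** Let $N$ be a set of signature constructor names, $L$ a set of labels. A *type name* over type variables $X_1,\dots,X_k$ is a variable $X_i$ or a *generic signature name* $(nm,[t_1,\dots,t_n])$ with $nm\in N$ and type names $t_i$; a *ground* signature name is one without variables. A *signature constructor* consists of a name in $N$, a finite sequence of distinct type variables, a finite list of supersignatures (generic signature names, so no naked variables), a finite list of field signatures $(a,t)$ and a finite list of method signatures $(b,[t_1,\dots,t_n]\to t)$, with $a,b\in L$ and type names over the declared variables; signature constructors are identified up to renaming of their type variables. A *signature constructor environment* (SCE) is a finite partial function $sce$ from $N$ to signature constructors. A type name is *well-formed in* $sce$ if every name of $N$ in it is bound by $sce$ and is applied to as many arguments as the constructor bound to it has type variables. An SCE is *well-formed* if every $nm$ in its domain is bound to a constructor named $nm$; no constructor declares two fields, or two methods, with the same label; all generic signature names inside its constructors are well-formed in it; the relation "$nm'$ is the head name of a declared supersignature of $sce(nm)$" has no cycles; and every field and method signature of the constructor named by a supersignature, with the type arguments of that supersignature substituted for the type variables, is also a field or method signature of the constructor that declares the supersignature. A *generic object signature* is a pair $gos=(g,sce)$ of a ground signature name and a well-formed SCE such that $g$ is well-formed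 in $sce$ and $sce$ is minimal, i.e. binds only names that occur in $g$ or are reached from those through names occurring inside constructors of $sce$. If $g=(nm,[\overline t])$, the *ground signature* of $gos$ is $sce(nm)$ with $\overline t$ substituted for its type variables. Let $gss(sce,g)$ be the set of names of all direct and indirect ground supersignatures of $g$, obtained by instantiating constructors in $sce$. *Subsigning* is defined, for pairs of a ground signature name and an SCE, by $$(g_2,sce_2)\trianglelefteq(g_1,sce_1)\iff sce_2\supseteq sce_1\ \wedge\ \bigl(g_2=g_1\ \vee\ g_1\in gss(sce_2,g_2)\bigr).$$ **Generic objects.** Let $\mathcal S$ be the flat domain of generic object signatures. For a pointed $\omega$-cpo $D$ let $D^*$ be the domain of finite sequences over $D$ (same length: componentwise order; plus a least element), $L\multimap D$ the domain of finite records (a finite label set with an element of $D$ for each label; same label set: componentwise order; plus a least element), and $D\to D'$ the $\omega$-continuous functions. Let $\hat O$ be the canonical (inverse limit) solution, obtained by iterating the right-hand side from the one-point domain, of $$O=\mathcal S\times(L\multimap O)\times\bigl(L\multimap(O^*\to O)\bigr).$$ Let $\mathrm{filter}:\hat O\to\hat O$ be the supremum of the iterates, starting from the constant function $\bot$, of the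 following recursion. A triple $(s,fr,mr)$ is sent to $\bot$ unless $s\neq\bot$, and $fr$, $mr$ are records whose label sets are exactly the field labels and method labels of the ground signature of $s$. In that case $s$ is kept, the value of a field declared with type $t$ is replaced by its filtering at $t$, and a method $m$ declared with type $[t_1,\dots,t_n]\to t$ is replaced by the function that filters its argument sequence at $[t_1,\dots,t_n]$ (sequences of another length become $\bot$, each $i$-th entry is filtered at $t_i$), applies $m$, and filters the result at $t$. Here filtering an object $o$ at $t$ gives $\mathrm{filter}(o)$ if the signature of $\mathrm{filter}(o)$ is not $\bot$ and subsigns $(t,sce_t)$, and $\bot$ otherwise, where $sce_t$ is the part of the SCE of $s$ that binds the names occurring in $t$ or reached from them. The domain of *generic objects* is $GO=\{o\in\hat O\mid \mathrm{filter}(o)=o\}$ with the order $\sqsubseteq$ of $\hat O$. The *generic object type* denoted by a generic object signature $gos$ is $$\mathbb{GS}(gos)=\{go\in GO\mid \text{there are a generic object signature } goss \text{ and records } gr \text{ with } (goss,gr)\in GO,\ goss\trianglelefteq gos,\ go\sqsubseteq(goss,gr)\}.$$ **Theorem (inheritance is subtyping).** For all generic object signatures $gos_1,gos_2$: $$gos_1\trianglelefteq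 gos_2\iff \mathbb{GS}(gos_1)\subseteq\mathbb{GS}(gos_2).$$ -/

import Mathlib

namespace GNOOP

open OmegaCompletePartialOrder

noncomputable section

set_option linter.unusedSectionVars false

/-! ## Generic signatures -/

section Signatures

/-- Type names (`GNX`) over the signature constructor names `N` and `k` type variables: a type
variable or a generic signature name. Type variables are represented by their positions in the
declaring sequence, so that equality is equality up to renaming of type variables. -/
inductive GNX (N : Type) (k : ℕ) : Type
  | var : Fin k → GNX N k
  | app : N → List (GNX N k) → GNX N k

/-- Ground signature names: those without type variables. -/
abbrev GGN (N : Type) : Type := GNX N 0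

variable {N L : Type}

/-- Name substitution. -/
def GNX.subst {k m : ℕ} (σ : Fin k → GNX N m) : GNX N k → GNX N m
  | .var i => σ i
  | .app nm args => .app nm (args.map (GNX.subst σ))

/-- The name `nm` occurs in a type name. -/
inductive GNX.Mentions {k : ℕ} (nm : N) : GNX N k → Prop
  | head (args : List (GNX N k)) : Mentions nm (.app nm args)
  | arg {nm' : N} {args : List (GNX N k)} {a : GNX N k} :
      a ∈ args → Mentions nm a → Mentions nm (.app nm' args)

/-- The signature constructor name of a ground signature name. -/
def GNX.head : GGN N → N
  | .app nm _ => nm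
  | .var i => i.elim0

/-- The type arguments of a ground signature name. -/
def GNX.args : GGN N → List (GGN N)
  | .app _ args => args
  | .var i => i.elim0

variable (N L) in
/-- Signature constructors: a name, a number of type variables, the supersignatures (generic
signature names, hence no naked type variables), the field signatures and the method signatures
(label, parameters, result). -/
structure SigCon : Type where
  name : N
  arity : ℕ
  supers : List (N × List (GNX N arity))
  fields : List (L × GNX N arity)
  methods : List (L × List (GNX N arity) × GNX N arity)

/-- The name `nm` occurs in (the supersignatures or member signatures of) `c`. -/
def SigCon.Mentions (c : SigCon N L) (nm : N) : Prop :=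
  (∃ s ∈ c.supers, (GNX.app s.1 s.2).Mentions nm) ∨
  (∃ f ∈ c.fields, f.2.Mentions nm) ∨
  (∃ m ∈ c.methods, (∃ t ∈ m.2.1, t.Mentions nm) ∨ m.2.2.Mentions nm)

variable (N L) in
/-- Ground signatures. -/
structure GroundSig : Type where
  name : GGN N
  supers : List (GGN N)
  fields : List (L × GGN N)
  methods : List (L × List (GGN N) × GGN N)

/-- A list of the right length as an assignment to the type variables. -/
def assign {k m : ℕ} (args : List (GNX N m)) (h : args.length = k) : Fin k → GNX N m :=
  fun i => args.get (i.cast h.symm)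

/-- Instantiation of a signature constructor with ground type arguments. -/
def SigCon.inst (c : SigCon N L) (σ : Fin c.arity → GGN N) : GroundSig N L where
  name := .app c.name (List.ofFn σ)
  supers := c.supers.map fun s => .app s.1 (s.2.map (GNX.subst σ))
  fields := c.fields.map fun f => (f.1, f.2.subst σ)
  methods := c.methods.map fun m => (m.1, m.2.1.map (GNX.subst σ), m.2.2.subst σ)

variable (N L) in
/-- Signature constructor environments: finite partial functions from names to signature
constructors. -/
@[ext] structure SCE : Type where
  get : N → Option (SigCon N L)
  finite : {nm | get nm ≠ none}.Finite

namespace SCE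

variable (e : SCE N L)

/-- Well-formedness of a type name in an environment: all names in it are bound, and
they have the right number of type arguments. -/
inductive WFName {k : ℕ} : GNX N k → Prop
  | var (i : Fin k) : WFName (.var i)
  | app {nm : N} {args : List (GNX N k)} {c : SigCon N L} :
      e.get nm = some c → args.length = c.arity → (∀ a ∈ args, WFName a) → WFName (.app nm args)

/-- `nm'` heads one of the declared supersignatures of `nm`. -/
def SuperName (nm nm' : N) : Prop :=
  ∃ c, e.get nm = some c ∧ ∃ s ∈ c.supers, s.1 = nm'

/-- Well-formed signature constructor environments. -/
structure WF : Prop where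
  /-- A name is bound to a signature constructor of that name. -/
  name_eq : ∀ nm c, e.get nm = some c → c.name = nm
  /-- No label is declared twice. -/
  nodup_fields : ∀ nm c, e.get nm = some c → (c.fields.map Prod.fst).Nodup
  nodup_methods : ∀ nm c, e.get nm = some c → (c.methods.map Prod.fst).Nodup
  /-- All names inside signature constructors are well-formed. -/
  wf_supers : ∀ nm c, e.get nm = some c → ∀ s ∈ c.supers, e.WFName (GNX.app s.1 s.2)
  wf_fields : ∀ nm c, e.get nm = some c → ∀ f ∈ c.fields, e.WFName f.2
  wf_methods : ∀ nm c, e.get nm = some c → ∀ m ∈ c.methods,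
    (∀ t ∈ m.2.1, e.WFName t) ∧ e.WFName m.2.2
  /-- There are no cycles in the supersignature hierarchy. -/
  acyclic : ∀ nm, ¬ Relation.TransGen e.SuperName nm nm
  /-- The members of a supersignature, instantiated as declared, are inherited. -/
  inherit_fields : ∀ nm c, e.get nm = some c → ∀ s ∈ c.supers, ∀ c', e.get s.1 = some c' →
    ∀ h : s.2.length = c'.arity, ∀ f ∈ c'.fields, (f.1, f.2.subst (assign s.2 h)) ∈ c.fields
  inherit_methods : ∀ nm c, e.get nm = some c → ∀ s ∈ c.supers, ∀ c', e.get s.1 = some c' →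
    ∀ h : s.2.length = c'.arity, ∀ m ∈ c'.methods,
      (m.1, m.2.1.map (GNX.subst (assign s.2 h)), m.2.2.subst (assign s.2 h)) ∈ c.methods

/-- `e` extends `e'`: every binding of `e'` is a binding of `e`. -/
def Extends (e' : SCE N L) : Prop := ∀ nm c, e'.get nm = some c → e.get nm = some c

/-- The ground signature named by a ground signature name, if there is one. -/
def ground (g : GGN N) : Option (GroundSig N L) :=
  (e.get g.head).bind fun c =>
    if h : g.args.length = c.arity then some (c.inst (assign g.args h)) else none

/-- The names of all ground supersignatures of a ground signature name. -/
def gss (g : GGN N) : Set (GGN N) :=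
  {g' | Relation.TransGen (fun a b => ∃ gs, e.ground a = some gs ∧ b ∈ gs.supers) g g'}

/-- `nm` is needed to interpret the ground signature name `g`. -/
def Reaches (g : GGN N) (nm : N) : Prop :=
  ∃ nm₀, g.Mentions nm₀ ∧
    Relation.ReflTransGen (fun a b => ∃ c, e.get a = some c ∧ c.Mentions b) nm₀ nm

open scoped Classical in
/-- The part of an environment that is needed to interpret a ground signature name. -/
def restrict (g : GGN N) : SCE N L where
  get nm := if e.Reaches g nm then e.get nm else none
  finite := e.finite.subset fun nm h => by
    simp only [Set.mem_ofPred_eq, ne_eq, ite_eq_right_iff, Classical.not_imp] at h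
    exact h.2

end SCE

variable (N L) in
/-- Pairs of a ground signature name and a signature constructor environment (not necessarily
well-formed). -/
structure RawSig : Type where
  name : GGN N
  env : SCE N L

/-- Well-formed generic object signatures: the environment is well-formed, the name is well-formed
in it, and the environment is minimal, that is, binds only names that the name depends on. -/
structure RawSig.WF (s : RawSig N L) : Prop where
  env : s.env.WF
  name : s.env.WFName s.name
  minimal : ∀ nm, s.env.get nm ≠ none → s.env.Reaches s.name nm

/-- The subsigning relation `s ⊴ t`: the environment of `s` extends that of `t`, and the name of
`t` is that of `s` or of one of the ground supersignatures of `s`. -/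
def RawSig.Subsigns (s t : RawSig N L) : Prop :=
  s.env.Extends t.env ∧ (s.name = t.name ∨ t.name ∈ s.env.gss s.name)

variable (N L) in
/-- Generic object signatures: the well-formed pairs. -/
def GOS : Type := {s : RawSig N L // s.WF}

theorem GOS.ground_ne_none (s : GOS N L) : (s.1.env.ground s.1.name).isSome := by
  obtain ⟨⟨g, e⟩, h⟩ := s
  have := h.name
  cases this with
  | var i => exact i.elim0
  | app h₁ h₂ h₃ =>
    simp only at h₁
    simp [SCE.ground, GNX.head, GNX.args, h₁, h₂]

/-- The ground signature defined by a generic object signature. -/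
def GOS.ground (s : GOS N L) : GroundSig N L := (s.1.env.ground s.1.name).get s.ground_ne_none

/-- `s ⊴ t` for generic object signatures. -/
def GOS.Subsigns (s t : GOS N L) : Prop := s.1.Subsigns t.1

/-- `σ` subsigns the object signature that a ground name `t` inside the ground signature of `s`
stands for: the name `t` with the part of the environment of `s` that it needs. -/
def GOS.HasType (s : GOS N L) (t : GGN N) (σ : GOS N L) : Prop :=
  σ.1.Subsigns ⟨t, s.1.env.restrict t⟩

open scoped Classical in
/-- The labels of the fields (below: of the methods) declared by the ground signature of `s`. -/
def GOS.fieldLabels (s : GOS N L) : Finset L := (s.ground.fields.map Prod.fst).toFinset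

open scoped Classical in
def GOS.methodLabels (s : GOS N L) : Finset L := (s.ground.methods.map Prod.fst).toFinset

end Signatures

/-! ## Domains -/

instance {A B : Type} [OmegaCompletePartialOrder A] [OmegaCompletePartialOrder B] [OrderBot B] :
    OrderBot (A →𝒄 B) where
  bot := ContinuousHom.const ⊥
  bot_le _ _ := bot_le

/-- The lifted (separated) sum of a family of domains: a new least element, and for every index
a copy of the corresponding summand, elements of different summands being incomparable. -/
inductive LSum {ι : Type} (A : ι → Type) : Type
  | bot : LSum A
  | mk (i : ι) (a : A i) : LSum A

namespace LSum

variable {ι : Type} {A B C : ι → Type}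

/-- The order of the lifted sum. -/
inductive Le [∀ i, LE (A i)] : LSum A → LSum A → Prop
  | bot_le (x : LSum A) : Le bot x
  | mk_le {i : ι} {a b : A i} (h : a ≤ b) : Le (mk i a) (mk i b)

variable [∀ i, OmegaCompletePartialOrder (A i)] [∀ i, OrderBot (A i)]
variable [∀ i, OmegaCompletePartialOrder (B i)] [∀ i, OrderBot (B i)]
variable [∀ i, OmegaCompletePartialOrder (C i)] [∀ i, OrderBot (C i)]

theorem chain_mono {X : Type} [OmegaCompletePartialOrder X] (c : Chain X) {m n : ℕ} (h : m ≤ n) :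
    c m ≤ c n := c.monotone h

instance : PartialOrder (LSum A) where
  le := Le
  le_refl x := by cases x <;> constructor; exact le_rfl
  le_trans x y z h k := by
    cases h with
    | bot_le => constructor
    | mk_le h => cases k with | mk_le k => exact .mk_le (h.trans k)
  le_antisymm x y h k := by
    cases h with
    | bot_le => cases k; rfl
    | mk_le h => cases k with | mk_le k => rw [le_antisymm h k]

instance : OrderBot (LSum A) where
  bot := bot
  bot_le := .bot_le

theorem mk_le_mk {i : ι} {a b : A i} : mk i a ≤ mk i b ↔ a ≤ b :=
  ⟨fun h => by cases h; assumption, .mk_le⟩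

theorem exists_of_mk_le {i : ι} {a : A i} {x : LSum A} (h : mk i a ≤ x) :
    ∃ b, x = mk i b ∧ a ≤ b := by
  cases h with | mk_le h => exact ⟨_, rfl, h⟩

open scoped Classical in
/-- The component of an element at index `i`, and `⊥` for an element of another summand. -/
def component (i : ι) : LSum A → A i
  | bot => ⊥
  | mk j a => if h : j = i then h ▸ a else ⊥

/-- The component at index `i` as a monotone map. -/
def proj (i : ι) : LSum A →o A i where
  toFun := component i
  monotone' x y h := by
    cases h with
    | bot_le => exact bot_le
    | mk_le h =>
      rename_i j a b
      by_cases e : j = i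
      · subst e; simpa [component] using h
      · simp [component, e]

@[simp] theorem proj_mk (i : ι) (a : A i) : proj i (mk i a) = a := by
  change component i (mk i a) = a
  simp [component]

open scoped Classical in
instance : OmegaCompletePartialOrder (LSum A) where
  ωSup c := if h : ∃ i n a, c n = mk i a then mk h.choose (ωSup (c.map (proj h.choose))) else bot
  le_ωSup c n := by
    cases e : c n with
    | bot => exact Le.bot_le _
    | mk i a =>
      have h : ∃ i n a, c n = mk i a := ⟨i, n, a, e⟩
      rw [dif_pos h]
      obtain ⟨m, b, hb⟩ := h.choose_spec
      generalize h.choose = j at b hb ⊢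
      have hij : i = j := by
        rcases le_total m n with h | h
        · have : c _ ≤ c _ := c.monotone h
          rw [e, hb] at this
          cases this; rfl
        · have : c _ ≤ c _ := c.monotone h
          rw [e, hb] at this
          cases this; rfl
      subst hij
      refine mk_le_mk.2 (le_ωSup_of_le n ?_)
      simp [e]
  ωSup_le c x hx := by
    split_ifs with h
    · obtain ⟨m, b, hb⟩ := h.choose_spec
      generalize h.choose = j at b hb ⊢
      obtain ⟨d, rfl, -⟩ := exists_of_mk_le (hb ▸ hx m)
      refine mk_le_mk.2 (ωSup_le _ _ fun k => ?_)
      simpa using (proj j).monotone (hx k)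
    · exact Le.bot_le _

theorem ωSup_eq_mk {c : Chain (LSum A)} {i : ι} {n : ℕ} {a : A i} (e : c n = mk i a) :
    ωSup c = mk i (ωSup (c.map (proj i))) := by
  obtain ⟨b, hb, -⟩ := exists_of_mk_le (e ▸ le_ωSup c n)
  apply le_antisymm
  · refine ωSup_le _ _ fun k => ?_
    obtain ⟨d, hd, -⟩ := exists_of_mk_le (e ▸ chain_mono c (le_max_left n k))
    refine (chain_mono c (le_max_right n k)).trans ?_
    rw [hd]
    refine mk_le_mk.2 (le_ωSup_of_le (max n k) ?_)
    simp [hd]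
  · rw [hb]
    refine mk_le_mk.2 (ωSup_le _ _ fun k => ?_)
    have := (proj i).monotone (le_ωSup c k)
    rwa [hb, proj_mk] at this

theorem ωSup_eq_bot {c : Chain (LSum A)} (h : ∀ n, c n = bot) : ωSup c = bot :=
  le_antisymm (ωSup_le _ _ fun k => (h k).le) (Le.bot_le _)

/-- The function underlying `elim`. -/
def elimFun {X : Type} [OmegaCompletePartialOrder X] [OrderBot X] (f : ∀ i, A i →𝒄 X) :
    LSum A → X
  | bot => ⊥
  | mk i a => f i a

/-- The strict map out of a lifted sum that is given by continuous maps on the summands. -/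
def elim {X : Type} [OmegaCompletePartialOrder X] [OrderBot X] (f : ∀ i, A i →𝒄 X) :
    LSum A →𝒄 X where
  toFun := elimFun f
  monotone' x y h := by
    cases h with
    | bot_le => exact bot_le
    | mk_le h => exact (f _).monotone h
  map_ωSup' c := by
    by_cases h : ∃ i n a, c n = mk i a
    · obtain ⟨i, n, a, e⟩ := h
      rw [ωSup_eq_mk e]
      change f i _ = _
      rw [(f i).continuous]
      apply le_antisymm
      · refine ωSup_le _ _ fun k => ?_
        obtain ⟨d, hd, -⟩ := exists_of_mk_le (e ▸ chain_mono c (le_max_left n k))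
        refine le_ωSup_of_le (max n k) ?_
        have h2 := (proj i).monotone (chain_mono c (le_max_right n k))
        rw [hd, proj_mk] at h2
        change f i (proj i (c k)) ≤ elimFun f (c (max n k))
        rw [hd]
        exact (f i).monotone h2
      · refine ωSup_le _ _ fun k => ?_
        change elimFun f (c k) ≤ _
        cases ek : c k with
        | bot => exact bot_le
        | mk j b =>
          have := ωSup_eq_mk ek
          rw [ωSup_eq_mk e] at this
          obtain rfl : i = j := by injection this
          refine le_ωSup_of_le k ?_
          change f i b ≤ f i (proj i (c k))
          rw [ek, proj_mk]
    · push Not at h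
      have h' : ∀ n, c n = bot := fun n => by
        cases e : c n with
        | bot => rfl
        | mk i a => exact absurd e (h i n a)
      rw [ωSup_eq_bot h']
      exact le_antisymm bot_le (ωSup_le _ _ fun k => by
        change elimFun f (c k) ≤ _
        exact (congrArg (elimFun f) (h' k)).le)

@[simp] theorem elim_bot {X : Type} [OmegaCompletePartialOrder X] [OrderBot X]
    (f : ∀ i, A i →𝒄 X) : elim f ⊥ = ⊥ := rfl

@[simp] theorem elim_mk {X : Type} [OmegaCompletePartialOrder X] [OrderBot X]
    (f : ∀ i, A i →𝒄 X) (i : ι) (a : A i) : elim f (mk i a) = f i a := rfl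

/-- The inclusion of a summand. -/
def inj (i : ι) : A i →𝒄 LSum A where
  toFun := mk i
  monotone' _ _ h := mk_le_mk.2 h
  map_ωSup' c := by
    rw [ωSup_eq_mk (c := c.map _) (n := 0) (i := i) (a := c 0) rfl]
    congr 2
    ext n
    exact (proj_mk i (c n)).symm

@[simp] theorem inj_apply (i : ι) (a : A i) : inj i a = mk i a := rfl

/-- Functoriality of the lifted sum. -/
def map (f : ∀ i, A i →𝒄 B i) : LSum A →𝒄 LSum B := elim fun i => (inj i).comp (f i)

@[simp] theorem map_bot (f : ∀ i, A i →𝒄 B i) : map f ⊥ = ⊥ := rfl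

@[simp] theorem map_mk (f : ∀ i, A i →𝒄 B i) (i : ι) (a : A i) :
    map f (mk i a) = mk i (f i a) := rfl

theorem map_map (g : ∀ i, B i →𝒄 C i) (f : ∀ i, A i →𝒄 B i) (x : LSum A) :
    map g (map f x) = map (fun i => (g i).comp (f i)) x := by
  cases x <;> rfl

theorem map_mono {f g : ∀ i, A i →𝒄 B i} (h : ∀ i, f i ≤ g i) : map f ≤ map g := by
  intro x
  cases x with
  | bot => exact le_rfl
  | mk i a => exact mk_le_mk.2 (h i a)

theorem elim_mono {X : Type} [OmegaCompletePartialOrder X] [OrderBot X]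
    {f g : ∀ i, A i →𝒄 X} (h : ∀ i, f i ≤ g i) : elim f ≤ elim g := by
  intro x
  cases x with
  | bot => exact le_rfl
  | mk i a => exact h i a

open scoped Classical in
/-- `guard P x y` is `y` if `x` lies in a summand whose index satisfies `P`, and `⊥` otherwise. -/
def guard {X : Type} [OmegaCompletePartialOrder X] [OrderBot X] (P : ι → Prop) :
    LSum A →𝒄 (X →𝒄 X) :=
  elim fun i => ContinuousHom.const (if P i then ContinuousHom.id else ⊥)

end LSum

/-- Application of a continuous family of maps, with a continuously varying argument. -/
def ap {X Y Z W : Type} [OmegaCompletePartialOrder X] [OmegaCompletePartialOrder Y]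
    [OmegaCompletePartialOrder Z] [OmegaCompletePartialOrder W]
    (F : Y →𝒄 (X →𝒄 W)) (a : Z →𝒄 Y) (b : Z →𝒄 X) : Z →𝒄 W :=
  .ofFun (fun z => F (a z) (b z)) (ContinuousHom.ωScottContinuous_apply
    (F.ωScottContinuous.comp a.ωScottContinuous) b.ωScottContinuous)

theorem ap_mono {X Y Z W : Type} [OmegaCompletePartialOrder X] [OmegaCompletePartialOrder Y]
    [OmegaCompletePartialOrder Z] [OmegaCompletePartialOrder W]
    {F F' : Y →𝒄 (X →𝒄 W)} (a : Z →𝒄 Y) {b b' : Z →𝒄 X} (hF : F ≤ F') (hb : b ≤ b') :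
    ap F a b ≤ ap F' a b' := by
  intro z
  change F (a z) (b z) ≤ F' (a z) (b' z)
  exact ContinuousHom.apply_mono (hF (a z)) (hb z)

theorem comp_mono {X Y Z : Type} [OmegaCompletePartialOrder X] [OmegaCompletePartialOrder Y]
    [OmegaCompletePartialOrder Z] (f : Y →𝒄 Z) {g g' : X →𝒄 Y} (h : g ≤ g') :
    f.comp g ≤ f.comp g' := fun x => f.monotone (h x)

section Functor

variable (S L : Type)

/-- The flat domain over a set. -/
abbrev Flat : Type := LSum fun _ : S => Unit

/-- The domain `D*` of finite sequences: sequences of the same length are compared componentwise,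
and there is an additional least element. -/
abbrev Seqs (D : Type) : Type := LSum fun n : ℕ => Fin n → D

/-- The domain `L ⊸ D` of finite records: a record has a finite set of labels and assigns an
element of `D` to each of them; records with different label sets are incomparable. -/
abbrev Records (D : Type) : Type := LSum fun T : Finset L => T → D

/-- The domain of methods `D* → D`. -/
abbrev Meth (D : Type) [OmegaCompletePartialOrder D] [OrderBot D] : Type := Seqs D →𝒄 D

/-- The domain `(L ⊸ D) × (L ⊸ (D* → D))` of object records. -/
abbrev ObjRecords (D : Type) [OmegaCompletePartialOrder D] [OrderBot D] : Type :=
  Records L D × Records L (Meth D)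

/-- The right-hand side `S × (L ⊸ D) × (L ⊸ (D* → D))` of the domain equation. -/
abbrev Obj (D : Type) [OmegaCompletePartialOrder D] [OrderBot D] : Type :=
  Flat S × ObjRecords L D

variable {S L}
variable {A B C : Type} [OmegaCompletePartialOrder A] [OrderBot A]
  [OmegaCompletePartialOrder B] [OrderBot B] [OmegaCompletePartialOrder C] [OrderBot C]

/-- Apply to the component with label (or index) `t` the map `f t`. -/
def piMap {T : Type} (f : T → A →𝒄 B) : (T → A) →𝒄 (T → B) :=
  .ofFun fun r t => f t (r t)

@[simp] theorem piMap_apply {T : Type} (f : T → A →𝒄 B) (r : T → A) (t : T) :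
    piMap f r t = f t (r t) := rfl

/-- Apply `f` to every entry of a sequence. -/
def Seqs.map (f : A →𝒄 B) : Seqs A →𝒄 Seqs B := LSum.map fun _ => piMap fun _ => f

/-- Apply `f a` to the field with label `a`. -/
def Records.map (f : L → A →𝒄 B) : Records L A →𝒄 Records L B :=
  LSum.map fun _ => piMap fun a => f a

/-- Pre- and postcomposition of a method with given maps. -/
def Meth.conj (f : A →𝒄 B) (g : Seqs B →𝒄 Seqs A) : Meth A →𝒄 Meth B where
  toFun m := f.comp (m.comp g)
  monotone' _ _ h x := f.monotone (h (g x))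
  map_ωSup' c := by
    ext x
    exact f.continuous _

@[simp] theorem Meth.conj_apply (f : A →𝒄 B) (g : Seqs B →𝒄 Seqs A) (m : Meth A) (x : Seqs B) :
    Meth.conj f g m x = f (m (g x)) := rfl

/-- The action of the right-hand side of the domain equation on a pair of maps. -/
def Obj.map (f : A →𝒄 B) (g : B →𝒄 A) : Obj S L A →𝒄 Obj S L B :=
  .ofFun fun x => (x.1, Records.map (fun _ => f) x.2.1,
    Records.map (fun _ => Meth.conj f (Seqs.map g)) x.2.2)


theorem Seqs.map_map (g : B →𝒄 C) (f : A →𝒄 B) (x : Seqs A) :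
    Seqs.map g (Seqs.map f x) = Seqs.map (g.comp f) x := LSum.map_map _ _ _

theorem Seqs.map_mono {f g : A →𝒄 B} (h : f ≤ g) : Seqs.map f ≤ Seqs.map g :=
  LSum.map_mono fun _ r t => h (r t)

theorem Records.map_map (g : L → B →𝒄 C) (f : L → A →𝒄 B) (x : Records L A) :
    Records.map g (Records.map f x) = Records.map (fun a => (g a).comp (f a)) x :=
  LSum.map_map _ _ _

theorem Records.map_mono {f g : L → A →𝒄 B} (h : ∀ a, f a ≤ g a) :
    Records.map f ≤ Records.map g :=
  LSum.map_mono fun _ r t => h t (r t)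

theorem Obj.map_map (f' : B →𝒄 C) (g' : C →𝒄 B) (f : A →𝒄 B) (g : B →𝒄 A) (x : Obj S L A) :
    Obj.map f' g' (Obj.map f g x) = Obj.map (f'.comp f) (g.comp g') x := by
  refine Prod.ext rfl (Prod.ext (Records.map_map _ _ _) ((Records.map_map _ _ _).trans ?_))
  change Records.map _ _ = Records.map _ _
  have h : (Meth.conj f' (Seqs.map g')).comp (Meth.conj f (Seqs.map g)) =
      Meth.conj (f'.comp f) (Seqs.map (g.comp g')) := by
    ext m y
    change f' (f (m (Seqs.map g (Seqs.map g' y)))) = f' (f (m (Seqs.map (g.comp g') y)))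
    rw [Seqs.map_map]
  rw [h]

theorem Meth.conj_mono {f f' : A →𝒄 B} {g g' : Seqs B →𝒄 Seqs A} (hf : f ≤ f') (hg : g ≤ g') :
    Meth.conj f g ≤ Meth.conj f' g' := by
  intro m y
  change f (m (g y)) ≤ f' (m (g' y))
  exact ContinuousHom.apply_mono hf (m.monotone (hg y))

theorem Obj.map_mono {f f' : A →𝒄 B} {g g' : B →𝒄 A} (hf : f ≤ f') (hg : g ≤ g') :
    (Obj.map f g : Obj S L A →𝒄 Obj S L B) ≤ Obj.map f' g' := fun x =>
  ⟨le_rfl, Records.map_mono (fun _ => hf) x.2.1,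
    Records.map_mono (fun _ => Meth.conj_mono hf (Seqs.map_mono hg)) x.2.2⟩

theorem Obj.map_id (x : Obj S L A) : Obj.map ContinuousHom.id ContinuousHom.id x = x := by
  have hs : ∀ y : Seqs A, Seqs.map ContinuousHom.id y = y := fun y => by cases y <;> rfl
  have hm : ∀ m : Meth A, Meth.conj ContinuousHom.id (Seqs.map ContinuousHom.id) m = m :=
    fun m => by ext y; exact congrArg m (hs y)
  obtain ⟨s, r, m⟩ := x
  refine Prod.ext rfl (Prod.ext ?_ ?_)
  · cases r <;> rfl
  · cases m with
    | bot => rfl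
    | mk T m => exact congrArg (LSum.mk T) (funext fun a => hm (m a))

/-- Suprema of chains of maps are preserved. -/
theorem Obj.le_of_map_le (r : ℕ → A →𝒄 A) (hr : Monotone r)
    (hl : ∀ x z, (∀ n, r n x ≤ z) → x ≤ z) (x z : Obj S L A)
    (h : ∀ n, Obj.map (r n) (r n) x ≤ z) : x ≤ z := by
  obtain ⟨s, u, m⟩ := x
  obtain ⟨s', u', m'⟩ := z
  refine ⟨(h 0).1, ?_, ?_⟩
  · have h' : ∀ n, Records.map (fun _ => r n) u ≤ u' := fun n => (h n).2.1
    cases u with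
    | bot => exact bot_le
    | mk T u =>
      obtain ⟨v, rfl, -⟩ := LSum.exists_of_mk_le (h' 0)
      exact LSum.mk_le_mk.2 fun a => hl _ _ fun n => LSum.mk_le_mk.1 (h' n) a
  · have h' : ∀ n, Records.map (fun _ => Meth.conj (r n) (Seqs.map (r n))) m ≤ m' :=
      fun n => (h n).2.2
    cases m with
    | bot => exact bot_le
    | mk T m =>
      obtain ⟨v, rfl, -⟩ := LSum.exists_of_mk_le (h' 0)
      refine LSum.mk_le_mk.2 fun a y => ?_
      have h₁ : ∀ n, r n (m a (Seqs.map (r n) y)) ≤ v a y := fun n => LSum.mk_le_mk.1 (h' n) a y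
      let c : Chain (Seqs A) :=
        ⟨fun n => Seqs.map (r n) y, fun i j hij => Seqs.map_mono (hr hij) y⟩
      have hy : y ≤ ωSup c := by
        cases y with
        | bot => exact bot_le
        | mk k y =>
          obtain ⟨z, hz, -⟩ := LSum.exists_of_mk_le (le_ωSup c 0)
          rw [hz]
          refine LSum.mk_le_mk.2 fun t => hl _ _ fun n => ?_
          have := le_ωSup c n
          rw [hz] at this
          exact LSum.mk_le_mk.1 this t
      refine ((m a).monotone hy).trans ?_
      rw [(m a).continuous]
      refine ωSup_le _ _ fun k => hl _ _ fun n => ?_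
      refine le_trans ?_ (h₁ (max n k))
      exact ContinuousHom.apply_mono (hr (le_max_left n k))
        ((m a).monotone (Seqs.map_mono (hr (le_max_right n k)) y))

end Functor

section Limit

/-- A pointed `ω`-cpo. -/
structure Dom where
  carrier : Type
  [cpo : OmegaCompletePartialOrder carrier]
  [orderBot : OrderBot carrier]

attribute [instance] Dom.cpo Dom.orderBot

instance : CoeSort Dom Type := ⟨Dom.carrier⟩

variable (S L : Type)

/-- The iterates of the right-hand side of the domain equation, from the one-point domain on. -/
def approx : ℕ → Dom
  | 0 => ⟨Unit⟩
  | n + 1 => ⟨Obj S L (approx n)⟩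

/-- The canonical maps between the iterates: embeddings in one direction, projections in
the other. -/
def trans : ∀ n m, approx S L n →𝒄 approx S L m
  | 0, _ => ⊥
  | _ + 1, 0 => ⊥
  | n + 1, m + 1 => (Obj.map (trans n m) (trans m n) :
      Obj S L (approx S L n) →𝒄 Obj S L (approx S L m))
termination_by n m => n + m

/-- The inverse limit of the iterates along the projections. -/
def PreObj : Type := {x : ∀ n, approx S L n // ∀ n, trans S L (n + 1) n (x (n + 1)) = x n}

variable {S L}

theorem trans_succ (n m : ℕ) : trans S L (n + 1) (m + 1) =
    (Obj.map (trans S L n m) (trans S L m n) :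
      Obj S L (approx S L n) →𝒄 Obj S L (approx S L m)) := by
  rw [trans]

theorem trans_zero (n : ℕ) (x : approx S L n) : trans S L n 0 x = ⊥ := by
  cases n <;> simp only [trans] <;> rfl

theorem zero_trans (n : ℕ) (x : approx S L 0) : trans S L 0 n x = ⊥ := by
  simp only [trans]; rfl

theorem trans_bot (n m : ℕ) : trans S L n m ⊥ = ⊥ := by
  cases n with
  | zero => exact zero_trans _ _
  | succ n =>
    cases m with
    | zero => exact trans_zero _ _
    | succ m => rw [trans_succ]; rfl

theorem trans_le (n m k : ℕ) : (trans S L m k).comp (trans S L n m) ≤ trans S L n k := by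
  match n, m, k with
  | n, m, 0 => intro x; simp [trans_zero]
  | 0, m, k => intro x; simp [zero_trans, trans_bot]
  | n + 1, 0, k + 1 => intro x; simp [zero_trans]
  | n + 1, m + 1, k + 1 =>
    intro x
    rw [trans_succ, trans_succ, trans_succ]
    refine (Obj.map_map _ _ _ _ _).le.trans ?_
    exact Obj.map_mono (trans_le n m k) (trans_le k m n) x
termination_by n + m + k

theorem trans_trans (n m k : ℕ) (h : n ≤ m ∨ k ≤ m) (x : approx S L n) :
    trans S L m k (trans S L n m x) = trans S L n k x := by
  match n, m, k with
  | n, m, 0 => simp [trans_zero]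
  | 0, m, k => simp [zero_trans, trans_bot]
  | n + 1, 0, k + 1 => omega
  | n + 1, m + 1, k + 1 =>
    rw [trans_succ, trans_succ, trans_succ]
    refine (Obj.map_map _ _ _ _ _).trans ?_
    congr 2
    · ext y; exact trans_trans n m k (by omega) y
    · ext y; exact trans_trans k m n (by omega) y
termination_by n + m + k

theorem trans_self (n : ℕ) (x : approx S L n) : trans S L n n x = x := by
  induction n with
  | zero => rfl
  | succ n ih =>
    rw [trans_succ]
    have : trans S L n n = ContinuousHom.id := by ext y; exact ih y
    rw [this]
    exact Obj.map_id x

namespace PreObj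

@[ext] theorem ext {x y : PreObj S L} (h : ∀ n, x.1 n = y.1 n) : x = y := Subtype.ext (funext h)

instance : OmegaCompletePartialOrder (PreObj S L) :=
  OmegaCompletePartialOrder.subtype _ fun c h n => by
    refine ((trans S L (n + 1) n).continuous (c.map (Pi.evalOrderHom (n + 1)))).trans ?_
    change ωSup _ = ωSup _
    congr 1
    ext k
    exact h (c k) ⟨k, rfl⟩ n

instance : OrderBot (PreObj S L) where
  bot := ⟨fun _ => ⊥, fun _ => trans_bot _ _⟩
  bot_le _ _ := bot_le

theorem trans_apply (x : PreObj S L) {m n : ℕ} (h : m ≤ n) : trans S L n m (x.1 n) = x.1 m := by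
  induction n, h using Nat.le_induction with
  | base => exact trans_self _ _
  | succ n h ih => rw [← trans_trans (n + 1) n m (by omega), x.2, ih]

/-- The projection to an iterate. -/
def π (n : ℕ) : PreObj S L →𝒄 approx S L n where
  toFun x := x.1 n
  monotone' _ _ h := h n
  map_ωSup' c := by
    rfl

/-- The embedding of an iterate. -/
def ι (n : ℕ) : approx S L n →𝒄 PreObj S L where
  toFun x := ⟨fun m => trans S L n m x, fun m => trans_trans _ _ _ (by omega) _⟩
  monotone' _ _ h m := (trans S L n m).monotone h
  map_ωSup' c := by
    ext m
    exact (trans S L n m).continuous c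

/-- The approximation of an element at a finite level. -/
def trunc (n : ℕ) : PreObj S L →𝒄 PreObj S L := (ι n).comp (π n)

theorem trunc_mono : Monotone (trunc (S := S) (L := L)) := by
  refine monotone_nat_of_le_succ fun n x m => ?_
  change trans S L n m (x.1 n) ≤ trans S L (n + 1) m (x.1 (n + 1))
  rw [← x.2 n]
  exact trans_le _ _ _ _

theorem le_of_trunc_le (x z : PreObj S L) (h : ∀ n, trunc n x ≤ z) : x ≤ z := fun n =>
  (trans_self n (x.1 n)).symm.le.trans (h n n)

/-- Build an object from its components. -/
def fold : Obj S L (PreObj S L) →𝒄 PreObj S L where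
  toFun y := ⟨fun | 0 => ⊥ | n + 1 => Obj.map (π n) (ι n) y, fun
    | 0 => trans_zero _ _
    | n + 1 => by
      rw [trans_succ]
      refine (Obj.map_map _ _ _ _ _).trans ?_
      congr 2
      · ext x; exact x.2 n
      · ext x m; exact trans_trans n (n + 1) m (by omega) x⟩
  monotone' _ _ h
    | 0 => le_rfl
    | n + 1 => (Obj.map (π n) (ι n)).monotone h
  map_ωSup' c := by
    ext n
    cases n with
    | zero => rfl
    | succ n => exact (Obj.map (π n) (ι n)).continuous c

/-- The finite-level approximations of the components of an object. -/
def components (x : PreObj S L) : Chain (Obj S L (PreObj S L)) where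
  toFun n := Obj.map (ι n) (π n) (x.1 (n + 1))
  monotone' := monotone_nat_of_le_succ fun n => by
    rw [← x.2 (n + 1), trans_succ]
    refine (Obj.map_map _ _ _ _ _).le.trans ?_
    refine Obj.map_mono ?_ ?_ _
    · intro y m
      exact trans_le (n + 1) n m y
    · intro y
      change trans S L n (n + 1) (y.1 n) ≤ y.1 (n + 1)
      rw [← y.2 n]
      exact (trans_le _ _ _ _).trans (trans_self _ _).le

theorem fold_components (x : PreObj S L) : fold (ωSup (components x)) = x := by
  ext n
  cases n with
  | zero => exact (trans_self _ _).symm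
  | succ n =>
    have key : ∀ k, Obj.map (π n) (ι n) (components x k) =
        trans S L (k + 1) (n + 1) (x.1 (k + 1)) := fun k => by
      rw [trans_succ]
      exact Obj.map_map _ _ _ _ _
    change Obj.map (π n) (ι n) (ωSup (components x)) = x.1 (n + 1)
    rw [ContinuousHom.continuous]
    apply le_antisymm
    · refine ωSup_le _ _ fun k => ?_
      refine (key k).le.trans ?_
      rcases le_total n k with h | h
      · exact (trans_apply x (by omega)).le
      · rw [← trans_apply x (m := k + 1) (n := n + 1) (by omega)]
        exact (trans_le _ _ _ _).trans (trans_self _ _).le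
    · refine le_ωSup_of_le n ((key n).trans (trans_self _ _)).ge

theorem components_fold (y : Obj S L (PreObj S L)) : ωSup (components (fold y)) = y := by
  have key : ∀ n, components (fold y) n = Obj.map (trunc n) (trunc n) y := fun n =>
    Obj.map_map _ _ _ _ _
  apply le_antisymm
  · refine ωSup_le _ _ fun n => (key n).le.trans ?_
    refine (Obj.map_mono (f' := ContinuousHom.id) (g' := ContinuousHom.id) ?_ ?_ y).trans
      (Obj.map_id y).le <;>
    · intro x m
      change trans S L n m (x.1 n) ≤ x.1 m
      rcases le_total m n with h | h
      · exact (trans_apply x h).le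
      · rw [← trans_apply x h]
        exact (trans_le _ _ _ _).trans (trans_self _ _).le
  · exact Obj.le_of_map_le trunc trunc_mono le_of_trunc_le _ _ fun n =>
      (key n).ge.trans (le_ωSup _ n)

/-- The inverse limit solves the domain equation. -/
def iso : PreObj S L ≃o Obj S L (PreObj S L) where
  toFun x := ωSup (components x)
  invFun := fold
  left_inv := fold_components
  right_inv := components_fold
  map_rel_iff' {x y} := by
    constructor
    · intro h
      have := fold.monotone h
      simpa only [Equiv.coe_fn_mk, fold_components] using this
    · intro h
      refine ωSup_le_ωSup_of_le fun n => ⟨n, (Obj.map (ι n) (π n)).monotone (h (n + 1))⟩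

/-- Take an object apart. -/
def unfold : PreObj S L →𝒄 Obj S L (PreObj S L) where
  toFun := iso
  monotone' := iso.monotone
  map_ωSup' c := by
    apply le_antisymm
    · rw [← iso.le_symm_apply]
      refine ωSup_le _ _ fun n => ?_
      rw [iso.le_symm_apply]
      exact le_ωSup_of_le n le_rfl
    · exact ωSup_le _ _ fun n => iso.monotone (le_ωSup c n)

/-- The three components of an object. -/
def sig : PreObj S L →𝒄 Flat S :=
  (ContinuousHom.ofFun Prod.fst).comp unfold

def fieldRec : PreObj S L →𝒄 Records L (PreObj S L) :=
  (ContinuousHom.ofFun fun y : Obj S L (PreObj S L) => y.2.1).comp unfold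

def methodRec : PreObj S L →𝒄 Records L (Meth (PreObj S L)) :=
  (ContinuousHom.ofFun fun y : Obj S L (PreObj S L) => y.2.2).comp unfold

/-- The object with signature `s` and the given records. -/
def build (s : S) : ObjRecords L (PreObj S L) →𝒄 PreObj S L :=
  fold.comp (ContinuousHom.ofFun fun r => (LSum.mk s (), r))

end PreObj
end Limit

/-! ## Generic objects -/

section Objects

variable (N L : Type)

/-- The canonical solution `O` of the domain equation `O = S × (L ⊸ O) × (L ⊸ (O* → O))`, where `S` is the
flat domain of generic object signatures, before filtering. -/
abbrev PreGO : Type := PreObj (GOS N L) L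

variable {N L}

/-- The object `(s, r)`. -/
def pair (s : GOS N L) (r : ObjRecords L (PreGO N L)) : PreGO N L :=
  PreObj.iso.symm (LSum.mk s (), r)

/-- Replace an object whose signature does not satisfy `P` by `⊥`. -/
def keep (P : GOS N L → Prop) : PreGO N L →𝒄 PreGO N L :=
  ap (LSum.guard P) PreObj.sig ContinuousHom.id

/-- Filtering relative to a ground name `t` inside `s`, where `g` filters objects. -/
def typeFilter (g : PreGO N L →𝒄 PreGO N L) (s : GOS N L) (t : GGN N) :
    PreGO N L →𝒄 PreGO N L :=
  (keep (s.HasType t)).comp g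

/-- Filtering of argument sequences relative to parameter types. -/
def argsFilter (g : PreGO N L →𝒄 PreGO N L) (s : GOS N L) (ts : List (GGN N)) :
    Seqs (PreGO N L) →𝒄 Seqs (PreGO N L) :=
  LSum.elim fun n =>
    if h : n = ts.length then
      (LSum.inj n).comp (piMap fun i => typeFilter g s (ts.get (i.cast h)))
    else ⊥

open scoped Classical in
/-- Filtering of the field with label `a`. -/
def fieldFilter (g : PreGO N L →𝒄 PreGO N L) (s : GOS N L) (a : L) :
    PreGO N L →𝒄 PreGO N L :=
  match s.ground.fields.lookup a with
  | some t => typeFilter g s t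
  | none => ⊥

open scoped Classical in
/-- Filtering of the method with label `b`: arguments and results are filtered. -/
def methodFilter (g : PreGO N L →𝒄 PreGO N L) (s : GOS N L) (b : L) :
    Meth (PreGO N L) →𝒄 Meth (PreGO N L) :=
  match s.ground.methods.lookup b with
  | some (ts, t) => Meth.conj (typeFilter g s t) (argsFilter g s ts)
  | none => ⊥

/-- Filtering of an object with signature `s`: its records must have exactly the labels
declared by `s`. -/
def objFilter (g : PreGO N L →𝒄 PreGO N L) (s : GOS N L) : PreGO N L →𝒄 PreGO N L :=
  ap (LSum.guard (· = s.fieldLabels)) PreObj.fieldRec <|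
  ap (LSum.guard (· = s.methodLabels)) PreObj.methodRec <|
  (PreObj.build s).comp <|
  ContinuousHom.ofFun fun x => ((Records.map (fieldFilter g s)).comp PreObj.fieldRec x,
    (Records.map (methodFilter g s)).comp PreObj.methodRec x)

/-- One unfolding of the recursive definition of filtering. -/
def filterStep (g : PreGO N L →𝒄 PreGO N L) : PreGO N L →𝒄 PreGO N L :=
  ap (LSum.elim fun s => ContinuousHom.const (objFilter g s)) PreObj.sig ContinuousHom.id

theorem filterStep_mono : Monotone (filterStep (N := N) (L := L)) := by
  intro g g' h
  have ht : ∀ s t, typeFilter g s t ≤ typeFilter g' s t := fun s t => comp_mono _ h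
  have ha : ∀ s ts, argsFilter g s ts ≤ argsFilter g' s ts := fun s ts => by
    refine LSum.elim_mono fun n => ?_
    split_ifs
    · exact comp_mono _ fun x i => ht s _ (x i)
    · exact le_rfl
  have hf : ∀ s a, fieldFilter g s a ≤ fieldFilter g' s a := fun s a => by
    unfold fieldFilter
    split
    · exact ht _ _
    · exact le_rfl
  have hm : ∀ s b, methodFilter g s b ≤ methodFilter g' s b := fun s b => by
    unfold methodFilter
    split
    · exact Meth.conj_mono (ht _ _) (ha _ _)
    · exact le_rfl
  have ho : ∀ s, objFilter g s ≤ objFilter g' s := fun s =>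
    ap_mono _ le_rfl <| ap_mono _ le_rfl <| comp_mono _ fun x =>
      ⟨Records.map_mono (hf s) (PreObj.fieldRec x), Records.map_mono (hm s) (PreObj.methodRec x)⟩
  refine ap_mono _ (LSum.elim_mono fun s _ => ho s) le_rfl

/-- Filtering: the least solution of `filter = filterStep filter`. -/
def filter : PreGO N L →𝒄 PreGO N L :=
  ωSup (fixedPoints.iterateChain ⟨filterStep, filterStep_mono⟩ ⊥ bot_le)

variable (N L) in
/-- The domain of generic objects: the objects that filtering leaves unchanged. -/
abbrev GO : Type := {o : PreGO N L // filter o = o}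

/-- The generic object type denoted by a generic object signature `s`: the generic objects that
approximate a generic object `(t, r)` whose signature `t` subsigns `s`. -/
def GS (s : GOS N L) : Set (GO N L) :=
  {o | ∃ (t : GOS N L) (r : ObjRecords L (PreGO N L)) (o' : GO N L),
    o'.1 = pair t r ∧ t.Subsigns s ∧ o ≤ o'}

end Objects
end
end GNOOP

namespace GNOOP

open OmegaCompletePartialOrder

/-! ### Subsigning as a preorder -/

section Signatures

variable {N L : Type}

/-! A generic object type collects what lies below the generic objects whose signature subsigns a
given one, so both directions reduce to properties of subsigning once enough generic objects are
available.

From subsigning to inclusion, transitivity suffices: a bound with signature `u ⊴ gos₁` is also a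
bound with signature `u ⊴ gos₂`. Transitivity (`RawSig.Subsigns.trans`) holds because enlarging an
environment can only add ground supersignatures.

For the converse, each signature `s` needs a generic object that remembers `s`. The least object
cannot serve, as it carries no signature. Instead take `s` with exactly the declared labels and `⊥`
at every label. These records are proper elements of the record domains, so filtering does not
reject them. Filtering is strict, so it leaves every member at `⊥` and the object is generic
(`filter_pair_undefinedRecords`). It lies in the type of `s` by reflexivity of subsigning. The
domain of signatures is flat, so any object `(u, r)` above it has `u = s`; hence it lies in the type
of `t` exactly when `s ⊴ t` (`undefinedObject_mem_GS_iff`). Testing an inclusion of types on this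
one object recovers subsigning. -/

/-- Only the binding of the head name matters for instantiation, and an extension keeps that
binding. -/
theorem SCE.Extends.ground_eq {e e' : SCE N L} (h : e.Extends e') {g : GGN N}
    {gs : GroundSig N L} (hg : e'.ground g = some gs) : e.ground g = some gs := by
  obtain ⟨c, hc, hgs⟩ := Option.bind_eq_some_iff.1 hg
  exact Option.bind_eq_some_iff.2 ⟨c, h _ _ hc, hgs⟩

theorem SCE.Extends.gss_subset {e e' : SCE N L} (h : e.Extends e') (g : GGN N) :
    e'.gss g ⊆ e.gss g := fun _ hg =>
  Relation.TransGen.mono (fun _ _ ⟨gs, hgs, hb⟩ => ⟨gs, h.ground_eq hgs, hb⟩) _ _ hg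

theorem RawSig.Subsigns.refl (s : RawSig N L) : s.Subsigns s := ⟨fun _ _ => id, .inl rfl⟩

/-- The two chains of supersignatures live in different environments, so the one for `t` is first
transported to the larger environment of `s`. Well-formedness plays no role. -/
theorem RawSig.Subsigns.trans {s t u : RawSig N L} (h : s.Subsigns t) (k : t.Subsigns u) :
    s.Subsigns u := by
  refine ⟨fun nm c hc => h.1 nm c (k.1 nm c hc), ?_⟩
  rcases k.2 with k₂ | k₂
  · rw [← k₂]
    exact h.2
  · have hu := h.1.gss_subset _ k₂
    rcases h.2 with h₂ | h₂
    · rw [h₂]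
      exact .inr hu
    · exact .inr (Relation.TransGen.trans h₂ hu)

end Signatures

/-! ### Strictness of filtering, and the objects with undefined members -/

section Objects

variable {N L : Type}

/-- Unfolding is an order isomorphism, so the least object has least components; in particular its
signature is `⊥`. -/
theorem PreObj.unfold_bot {S L : Type} :
    PreObj.unfold (⊥ : PreObj S L) = ⊥ := PreObj.iso.map_bot

theorem PreObj.sig_bot {S L : Type} : PreObj.sig (⊥ : PreObj S L) = ⊥ :=
  congrArg Prod.fst PreObj.unfold_bot

theorem unfold_pair (s : GOS N L) (r : ObjRecords L (PreGO N L)) :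
    PreObj.unfold (pair s r) = (LSum.mk s (), r) := PreObj.iso.apply_symm_apply _

theorem sig_pair (s : GOS N L) (r : ObjRecords L (PreGO N L)) :
    PreObj.sig (pair s r) = LSum.mk s () := congrArg Prod.fst (unfold_pair s r)

theorem fieldRec_pair (s : GOS N L) (r : ObjRecords L (PreGO N L)) :
    PreObj.fieldRec (pair s r) = r.1 := congrArg (·.2.1) (unfold_pair s r)

theorem methodRec_pair (s : GOS N L) (r : ObjRecords L (PreGO N L)) :
    PreObj.methodRec (pair s r) = r.2 := congrArg (·.2.2) (unfold_pair s r)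

/-- The signature projection is monotone, and in a flat domain two comparable proper elements
coincide. -/
theorem eq_of_pair_le_pair {s t : GOS N L} {r r' : ObjRecords L (PreGO N L)}
    (h : pair s r ≤ pair t r') : s = t := by
  have := PreObj.sig.monotone h
  rw [sig_pair, sig_pair] at this
  cases this
  rfl

/-- The test eliminates the signature strictly, so a signature `⊥` gives the map `⊥` whatever `P`
is. -/
theorem keep_bot (P : GOS N L → Prop) : keep P (⊥ : PreGO N L) = ⊥ := by
  change LSum.guard P (PreObj.sig (⊥ : PreGO N L)) (⊥ : PreGO N L) = ⊥
  rw [PreObj.sig_bot]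
  rfl

theorem filterStep_bot (g : PreGO N L →𝒄 PreGO N L) : filterStep g ⊥ = ⊥ := by
  change LSum.elim (fun s => ContinuousHom.const (objFilter g s))
    (PreObj.sig (⊥ : PreGO N L)) (⊥ : PreGO N L) = ⊥
  rw [PreObj.sig_bot]
  rfl

theorem typeFilter_bot {g : PreGO N L →𝒄 PreGO N L} (hg : g ⊥ = ⊥) (s : GOS N L) (t : GGN N) :
    typeFilter g s t ⊥ = ⊥ := by
  change keep _ (g ⊥) = ⊥
  rw [hg, keep_bot]

theorem fieldFilter_bot {g : PreGO N L →𝒄 PreGO N L} (hg : g ⊥ = ⊥) (s : GOS N L) (a : L) :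
    fieldFilter g s a ⊥ = ⊥ := by
  unfold fieldFilter
  split
  · exact typeFilter_bot hg _ _
  · rfl

theorem methodFilter_bot {g : PreGO N L →𝒄 PreGO N L} (hg : g ⊥ = ⊥) (s : GOS N L) (b : L) :
    methodFilter g s b ⊥ = ⊥ := by
  unfold methodFilter
  split
  -- The method `⊥` returns `⊥` on every argument sequence, so the filtering of arguments is
  -- irrelevant and strictness of the result filter is enough.
  · exact ContinuousHom.ext _ _ fun _ => typeFilter_bot hg _ _
  · rfl

/-- The records with the labels declared by `s` all of whose members are undefined. -/
noncomputable def undefinedRecords (s : GOS N L) : ObjRecords L (PreGO N L) :=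
  (LSum.mk s.fieldLabels ⊥, LSum.mk s.methodLabels ⊥)

/-- Stated for an arbitrary strict `g` so that it applies to each iterate in the construction of
`filter`; the equation `filter = filterStep filter` is then not needed. -/
theorem filterStep_pair_undefinedRecords {g : PreGO N L →𝒄 PreGO N L} (hg : g ⊥ = ⊥)
    (s : GOS N L) :
    filterStep g (pair s (undefinedRecords s)) = pair s (undefinedRecords s) := by
  set x := pair s (undefinedRecords s) with hx
  change LSum.elim (fun s => ContinuousHom.const (objFilter g s)) (PreObj.sig x) x = x
  rw [hx, sig_pair, ← hx]
  -- With the signature evaluated to `s`, this is `objFilter g s x` by definition: `ap` acts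
  -- pointwise, and `build s` agrees with `pair s` since `fold` is the inverse of `iso`.
  change LSum.guard (· = s.fieldLabels) (PreObj.fieldRec x)
    (LSum.guard (· = s.methodLabels) (PreObj.methodRec x)
    (pair s (Records.map (fieldFilter g s) (PreObj.fieldRec x),
      Records.map (methodFilter g s) (PreObj.methodRec x)))) = x
  rw [hx, fieldRec_pair, methodRec_pair]
  have hf : Records.map (fieldFilter g s) (undefinedRecords s).1 = (undefinedRecords s).1 :=
    congrArg (LSum.mk _) (funext fun a => fieldFilter_bot hg s a)
  have hm : Records.map (methodFilter g s) (undefinedRecords s).2 = (undefinedRecords s).2 :=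
    congrArg (LSum.mk _) (funext fun b => methodFilter_bot hg s b)
  rw [hf, hm]
  -- Both label sets are the declared ones, so each guard is the identity.
  simp [undefinedRecords, LSum.guard]

/-- All iterates are strict, so every iterate from index 1 on fixes the object, and so does their
supremum. -/
theorem filter_pair_undefinedRecords (s : GOS N L) :
    filter (pair s (undefinedRecords s)) = pair s (undefinedRecords s) := by
  let c := fixedPoints.iterateChain ⟨filterStep, filterStep_mono⟩
    (⊥ : PreGO N L →𝒄 PreGO N L) bot_le
  have hc : ∀ n, c (n + 1) = filterStep (c n) := fun n =>
    Function.iterate_succ_apply' filterStep n ⊥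
  have hbot : ∀ n, c n ⊥ = ⊥ := fun n => by
    cases n with
    | zero => rfl
    | succ n => rw [hc, filterStep_bot]
  have hpair : ∀ n, c (n + 1) (pair s (undefinedRecords s)) = pair s (undefinedRecords s) :=
    fun n => by rw [hc, filterStep_pair_undefinedRecords (hbot n)]
  change ωSup c (pair s (undefinedRecords s)) = _
  apply le_antisymm
  · refine ωSup_le _ _ fun n => ?_
    -- Passing to index `n + 1` also covers index 0, where the iterate is constantly `⊥` and does
    -- not fix the object.
    exact (c.monotone n.le_succ _).trans (hpair n).le
  · exact (hpair 0).ge.trans (le_ωSup c 1 _)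

/-- The generic object with signature `s` all of whose members are undefined. -/
noncomputable def undefinedObject (s : GOS N L) : GO N L :=
  ⟨pair s (undefinedRecords s), filter_pair_undefinedRecords s⟩

theorem GS_mono {s t : GOS N L} (h : s.Subsigns t) : GS s ⊆ GS t :=
  fun _ ⟨u, r, o', ho', hu, hle⟩ => ⟨u, r, o', ho', RawSig.Subsigns.trans hu h, hle⟩

/-- Any bound `(u, r)` witnessing membership must have `u = s`, so the witness `u ⊴ t` is already
the subsigning sought. -/
theorem undefinedObject_mem_GS_iff {s t : GOS N L} :
    undefinedObject s ∈ GS t ↔ s.Subsigns t := by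
  constructor
  · rintro ⟨u, r, o', ho', hu, hle⟩
    have hle' : pair s (undefinedRecords s) ≤ pair u r := ho' ▸ hle
    rwa [eq_of_pair_le_pair hle']
  · exact fun h => ⟨s, undefinedRecords s, undefinedObject s, rfl, h, le_rfl⟩

end Objects

end GNOOP

theorem mainTheorem1 {N L : Type} (gos₁ gos₂ : GNOOP.GOS N L) :
    gos₁.Subsigns gos₂ ↔ GNOOP.GS gos₁ ⊆ GNOOP.GS gos₂ :=
  ⟨GNOOP.GS_mono, fun h => GNOOP.undefinedObject_mem_GS_iff.1
    (h (GNOOP.undefinedObject_mem_GS_iff.2 (GNOOP.RawSig.Subsigns.refl _)))⟩
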